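/- A \emph{variety of groups} is a class $\mathcal V$ of groups closed under Cartesian products, subgroups and quotients (homomorphic images). A subset $X$ of a group $G$ is \emph{$\mathcal V$-independent} if the subgroup $\langle X\rangle$ generated by $X$ belongs to $\mathcal V$ and, for every $H\in\mathcal V$, every map $f:X\to H$ extends to a homomorphism $\langle X\rangle\to H$. The \emph{$\mathcal V$-rank} of $G\in\mathcal V$ is $r_{\mathcal V}(G)=\sup\{|X| : X\subseteq G \text{ is } \mathcal V\text{-independent}\}$, and a group is \emph{$\mathcal V$-free} if it is generated by a $\mathcal V$-independent subset. A subgroup $D$ of a topological group $G$ is \emph{$G_\delta$-dense} if it meets every non-empty $G_\delta$-subset of $G$. A space is \emph{pseudocompact} if every continuous real-valued function on it is bounded. The \emph{weight} $w(X)$ of a space $X$ is the least cardinality of a base of $X$, and $X$ is \emph{$w$-compact} if it has a compact subset $C$ with $w(C)=w(X)$. \textbf{Theorem.} Let $\mathcal V$ be a variety of groups and let $L\in\mathcal V$ be a compact metrizable topological group such that $r_{\mathcal V}(L^{\omega})\ge\omega$. Let $I$ be a set with $\omega_1\le |I|\le\mathfrak c$. Then the topological group $L^I$ (with the product topology) contains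 a $G_\delta$-dense, hence dense and pseudocompact, $\mathcal V$-free subgroup $D$ of cardinality $\mathfrak c$ such that all compact subsets of $D$ are countable; in particular, $D$ is not $w$-compact. -/

import Mathlib

open Cardinal

universe u

/-- A variety of groups: a class of groups closed under Cartesian products, subgroups and
quotients. Quotients are taken in the form of homomorphic images, so that the class is also
closed under isomorphism. -/
structure GroupVariety where
  /-- Membership of a group in the class. -/
  Mem : (G : Type u) → [Group G] → Prop
  pi_mem : ∀ (ι : Type u) (G : ι → Type u) [∀ i, Group (G i)],
    (∀ i, Mem (G i)) → Mem (∀ i, G i)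
  subgroup_mem : ∀ (G : Type u) [Group G] (H : Subgroup G), Mem G → Mem H
  quotient_mem : ∀ (G H : Type u) [Group G] [Group H] (f : G →* H),
    Function.Surjective f → Mem G → Mem H

namespace GroupVariety

/-- `X ⊆ G` is `V`-independent: `⟨X⟩` belongs to `V`, and every map from `X` to a group of `V`
extends to a homomorphism on `⟨X⟩`. -/
def Independent (V : GroupVariety.{u}) {G : Type u} [Group G] (X : Set G) : Prop :=
  V.Mem (Subgroup.closure X) ∧
    ∀ (H : Type u) [Group H], V.Mem H → ∀ f : X → H,
      ∃ φ : Subgroup.closure X →* H, ∀ x : X, φ ⟨x, Subgroup.subset_closure x.2⟩ = f x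

/-- The `V`-rank of `G`: the supremum of the cardinalities of its `V`-independent subsets. -/
noncomputable def rank (V : GroupVariety.{u}) (G : Type u) [Group G] : Cardinal.{u} :=
  ⨆ X : {X : Set G // V.Independent X}, #(X : Set G)

/-- `G` is `V`-free: it is generated by a `V`-independent subset. -/
def IsFree (V : GroupVariety.{u}) (G : Type u) [Group G] : Prop :=
  ∃ X : Set G, V.Independent X ∧ Subgroup.closure X = ⊤

end GroupVariety

/-- `D` meets every non-empty `G_δ`-subset of `X`. -/
def GDeltaDense {X : Type u} [TopologicalSpace X] (D : Set X) : Prop :=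
  ∀ B : Set X, IsGδ B → B.Nonempty → (D ∩ B).Nonempty

/-- Every continuous real-valued function on `X` is bounded. -/
def IsPseudocompact (X : Type u) [TopologicalSpace X] : Prop :=
  ∀ f : X → ℝ, Continuous f → ∃ M : ℝ, ∀ x, |f x| ≤ M

/-- The weight of `X`: the least cardinality of a base of its topology. -/
noncomputable def topWeight (X : Type u) [TopologicalSpace X] : Cardinal.{u} :=
  sInf {κ | ∃ B : Set (Set X), TopologicalSpace.IsTopologicalBasis B ∧ #B = κ}

/-- `X` is `w`-compact: it has a compact subset of the same weight as `X`. -/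
def IsWCompact (X : Type u) [TopologicalSpace X] : Prop :=
  ∃ C : Set X, IsCompact C ∧ topWeight C = topWeight X

/-! Split `I` into |I| blocks, each a copy of ω×ω, so that `L^I` restricts on every block to the
Polish group M = L^(ω×ω). Finite independent sets in L^ω, indexed by initial segments of bit
strings, yield 𝔠 independent elements of M (`exists_indepFamily_nat_bool`). A Bernstein-type
thinning discards, for each of the at most 𝔠 uncountable closed sets K in the subgroup they
generate, one generator that some element of K needs; the subgroup generated by the remaining family
`y` then contains no uncountable closed set (`IndepFamily.exists_reindex`). The generators of D are
indexed by the 𝔠 choices of countably many blocks with values there; each takes those values and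
repeats `y t` on all other blocks (`spread`). Thus D projects onto every countable subproduct, which
gives G_δ-density and pseudocompactness. Any word in the generators, read on all but countably many
blocks, is the same word in `y`. Hence D is free, and the induced bijection onto ⟨y⟩ sends compact
sets to closed, hence countable, ones (`isClosed_lift_image`). -/

namespace GroupVariety

/-! ### Independence in terms of words and laws. -/

variable {V : GroupVariety.{u}}

/-- The word `w` is a law of `V`: it is trivial under every substitution of elements of a group
of `V`. -/
def IsLaw (V : GroupVariety.{u}) {T : Type*} (w : FreeGroup T) : Prop :=
  ∀ (H : Type u) [Group H], V.Mem H → ∀ g : T → H, FreeGroup.lift g w = 1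

/-- The family `y` satisfies no relations other than the laws of `V`. -/
def IndepFamily (V : GroupVariety.{u}) {T : Type*} {G : Type*} [Group G] (y : T → G) : Prop :=
  ∀ w : FreeGroup T, FreeGroup.lift y w = 1 → V.IsLaw w

theorem lift_map_apply {S T G : Type*} [Group G] (g : T → G) (j : S → T) (w : FreeGroup S) :
    FreeGroup.lift g (FreeGroup.map j w) = FreeGroup.lift (g ∘ j) w := by
  have : (FreeGroup.lift g).comp (FreeGroup.map j) = FreeGroup.lift (g ∘ j) := by ext; simp
  exact DFunLike.congr_fun this w

theorem map_lift_apply {T G H : Type*} [Group G] [Group H] (φ : G →* H) (g : T → G)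
    (w : FreeGroup T) : φ (FreeGroup.lift g w) = FreeGroup.lift (φ ∘ g) w := by
  have : φ.comp (FreeGroup.lift g) = FreeGroup.lift (φ ∘ g) := by ext; simp
  exact DFunLike.congr_fun this w

theorem IsLaw.map {S T : Type*} {w : FreeGroup S} (hw : V.IsLaw w) (j : S → T) :
    V.IsLaw (FreeGroup.map j w) := fun H _ hH g ↦ by
  rw [lift_map_apply]; exact hw H hH _

theorem IsLaw.of_map {S T : Type*} {w : FreeGroup S} {j : S → T} (hj : Function.Injective j)
    (hw : V.IsLaw (FreeGroup.map j w)) : V.IsLaw w := fun H _ hH g ↦ by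
  have := hw H hH (Function.extend j g 1)
  rwa [lift_map_apply, Function.extend_comp hj] at this

namespace IndepFamily

theorem of_hom_comp {T G H : Type*} [Group G] [Group H] {y : T → G} (φ : G →* H)
    (h : V.IndepFamily (φ ∘ y)) : V.IndepFamily y := fun w hw ↦
  h w (by rw [← map_lift_apply, hw, map_one])

theorem comp_injective {S T G : Type*} [Group G] {y : T → G} (h : V.IndepFamily y) {j : S → T}
    (hj : Function.Injective j) : V.IndepFamily (y ∘ j) := fun w hw ↦
  IsLaw.of_map hj (h _ (by rw [lift_map_apply, hw]))

theorem exists_finset_map {T : Type*} (w : FreeGroup T) :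
    ∃ (F : Finset T) (w' : FreeGroup F), FreeGroup.map Subtype.val w' = w := by
  classical
  have key : ∀ (F F' : Finset T) (_ : F ⊆ F') (w' : FreeGroup F),
      ∃ w'' : FreeGroup F', FreeGroup.map Subtype.val w'' = FreeGroup.map Subtype.val w' := by
    intro F F' hF w'
    refine ⟨FreeGroup.map (fun x ↦ ⟨x.1, hF x.2⟩) w', ?_⟩
    rw [FreeGroup.map.comp]; rfl
  induction w using FreeGroup.induction_on with
  | C1 => exact ⟨∅, 1, map_one _⟩
  | of t => exact ⟨{t}, FreeGroup.of ⟨t, by simp⟩, by simp⟩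
  | inv_of t h => exact ⟨{t}, (FreeGroup.of ⟨t, by simp⟩)⁻¹, by simp⟩
  | mul a b ha hb =>
    obtain ⟨F, a', rfl⟩ := ha
    obtain ⟨F', b', rfl⟩ := hb
    obtain ⟨a'', ha⟩ := key F (F ∪ F') Finset.subset_union_left a'
    obtain ⟨b'', hb⟩ := key F' (F ∪ F') Finset.subset_union_right b'
    exact ⟨F ∪ F', a'' * b'', by rw [map_mul, ha, hb]⟩

/-- Independence has finite character. -/
theorem of_finset {T G : Type*} [Group G] {y : T → G}
    (h : ∀ F : Finset T, V.IndepFamily (fun t : F ↦ y t)) : V.IndepFamily y := fun w hw ↦ by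
  obtain ⟨F, w', rfl⟩ := exists_finset_map w
  rw [lift_map_apply] at hw
  exact (h F w' hw).map _

/-- Evaluation of words is determined up to laws by evaluation at an independent family. -/
theorem lift_eq_lift {T G : Type*} [Group G] {y : T → G} (h : V.IndepFamily y)
    {w w' : FreeGroup T} (hw : FreeGroup.lift y w = FreeGroup.lift y w') {H : Type u} [Group H]
    (hH : V.Mem H) (g : T → H) : FreeGroup.lift g w = FreeGroup.lift g w' := by
  have := h (w * w'⁻¹) (by rw [map_mul, map_inv, hw, mul_inv_cancel]) H hH g
  rwa [map_mul, map_inv, mul_inv_eq_one] at this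

/-- The kernel of `FreeGroup.lift y` consists of laws, which die in every group of `V`, so any
assignment on the generators descends to the generated subgroup. -/
theorem independent_range {T : Type*} {G : Type u} [Group G] {y : T → G} (h : V.IndepFamily y)
    (hG : V.Mem G) : V.Independent (Set.range y) := by
  refine ⟨V.subgroup_mem G _ hG, fun H _ hH f ↦ ?_⟩
  have hsurj : Function.Surjective
      ((FreeGroup.lift y).codRestrict (Subgroup.closure (Set.range y)) fun w ↦ by
        rw [← FreeGroup.range_lift_eq_closure]; exact ⟨w, rfl⟩) := by
    rintro ⟨a, ha⟩
    rw [← FreeGroup.range_lift_eq_closure] at ha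
    obtain ⟨w, rfl⟩ := ha
    exact ⟨w, rfl⟩
  let g : FreeGroup T →* H := FreeGroup.lift fun t ↦ f ⟨y t, t, rfl⟩
  refine ⟨MonoidHom.liftOfSurjective _ hsurj ⟨g, fun w hw ↦ ?_⟩, ?_⟩
  · exact h w (by simpa [MonoidHom.mem_ker, Subtype.ext_iff] using hw) H hH _
  · rintro ⟨_, t, rfl⟩
    have := MonoidHom.liftOfRightInverse_comp_apply _ _
      (Function.rightInverse_surjInv hsurj) (⟨g, fun w hw ↦
        h w (by simpa [MonoidHom.mem_ker, Subtype.ext_iff] using hw) H hH _⟩) (FreeGroup.of t)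
    simpa [g] using this

end IndepFamily

theorem Independent.indepFamily {G : Type u} [Group G] {X : Set G} (h : V.Independent X) :
    V.IndepFamily (Subtype.val : X → G) := fun w hw H _ hH g ↦ by
  obtain ⟨φ, hφ⟩ := h.2 H hH g
  let ι : X → Subgroup.closure X := fun x ↦ ⟨x, Subgroup.subset_closure x.2⟩
  have h1 : FreeGroup.lift ι w = 1 := by
    apply (Subgroup.closure X).subtype_injective
    rw [map_lift_apply, map_one]; exact hw
  have h2 : φ ∘ ι = g := funext hφ
  rw [← h2, ← map_lift_apply, h1, map_one]

theorem mem_pi {ι : Type} (V : GroupVariety.{u}) {G : Type u} [Group G] (hG : V.Mem G) :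
    V.Mem (ι → G) :=
  V.quotient_mem (ULift.{u} ι → G) (ι → G)
    { toFun := fun f i ↦ f ⟨i⟩, map_one' := rfl, map_mul' := fun _ _ ↦ rfl }
    (fun f ↦ ⟨fun i ↦ f i.down, rfl⟩) (V.pi_mem _ _ fun _ ↦ hG)

theorem closure_image_eq_map {T G : Type*} [Group G] (y : T → G) (F : Set T) :
    Subgroup.closure (y '' F) = (Subgroup.closure (FreeGroup.of '' F)).map (FreeGroup.lift y) := by
  rw [MonoidHom.map_closure, ← Set.image_comp]
  congr 1
  ext; simp

/-- Each element generated by an independent family has a least support. -/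
theorem IndepFamily.exists_support {T : Type*} {G : Type u} [Group G] {y : T → G}
    (h : V.IndepFamily y) (hG : V.Mem G) {k : G} (hk : k ∈ Subgroup.closure (Set.range y)) :
    k ∈ Subgroup.closure (y '' {s | k ∉ Subgroup.closure (y '' {s}ᶜ)}) := by
  classical
  have hex : ∃ F : Finset T, k ∈ Subgroup.closure (y '' (F : Set T)) := by
    rw [← FreeGroup.range_lift_eq_closure] at hk
    obtain ⟨w, rfl⟩ := hk
    obtain ⟨F, w', rfl⟩ := exists_finset_map w
    refine ⟨F, ?_⟩
    rw [lift_map_apply]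
    have : y '' (F : Set T) = Set.range (y ∘ (Subtype.val : F → T)) := by
      rw [Set.range_comp]; simp
    rw [this, ← FreeGroup.range_lift_eq_closure]
    exact ⟨w', rfl⟩
  obtain ⟨F, hF, hmin⟩ := WellFounded.has_min (measure Finset.card).wf
    {F : Finset T | k ∈ Subgroup.closure (y '' (F : Set T))} hex
  -- A generating set `F` of least size lies in the support: a dispensable `s ∈ F` could be erased.
  refine Subgroup.closure_mono (Set.image_mono fun s hs hks ↦ ?_) hF
  refine hmin (F.erase s) ?_ (Finset.card_erase_lt_of_mem hs)
  have hF' : k ∈ Subgroup.closure (y '' (F : Set T)) := hF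
  rw [closure_image_eq_map] at hF' hks
  obtain ⟨w₁, hw₁, rfl⟩ := hF'
  obtain ⟨w₂, hw₂, hw⟩ := hks
  -- Killing the letter `s` leaves the value of `w₂` unchanged, since `w₂` avoids `s`, and sends
  -- `w₁` into the span of `F.erase s`; independence makes the two values equal.
  let g : T → G := fun t ↦ if t = s then 1 else y t
  have e₁ : FreeGroup.lift g w₂ = FreeGroup.lift y w₂ := by
    refine MonoidHom.eqOn_closure (f := FreeGroup.lift g) (g := FreeGroup.lift y) ?_ hw₂
    rintro _ ⟨t, ht, rfl⟩
    have ht' : t ≠ s := ht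
    simp [g, ht']
  have e₂ := h.lift_eq_lift hw hG g
  rw [Set.mem_ofPred_eq, ← hw, ← e₁, e₂]
  have : (Subgroup.closure (FreeGroup.of '' (F : Set T))).map (FreeGroup.lift g) ≤
      Subgroup.closure (y '' (F.erase s : Finset T)) := by
    rw [← closure_image_eq_map, Subgroup.closure_le]
    rintro _ ⟨t, ht, rfl⟩
    by_cases hts : t = s
    · simp [g, hts, one_mem]
    · simp only [g, hts, if_false]
      exact Subgroup.subset_closure ⟨t, by simpa [hts] using ht, rfl⟩
  exact this ⟨w₁, hw₁, rfl⟩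

end GroupVariety

/-! ### Cardinality of subgroups, injective choices and closed sets. -/

theorem Subgroup.mk_closure_le {G : Type u} [Group G] (X : Set G) :
    #(Subgroup.closure X) ≤ max #X ℵ₀ := by
  rw [FreeGroup.closure_eq_range]
  refine (mk_range_le (f := FreeGroup.lift ((↑) : X → G))).trans ?_
  rcases isEmpty_or_nonempty X with h | h
  · exact (le_one_iff_subsingleton.2 inferInstance).trans (one_le_aleph0.trans (le_max_right _ _))
  · exact (mk_freeGroup _).le

/-- A family of sets, none of which is smaller than its index type, has an injective choice
function. -/
theorem exists_injective_forall_mem {ι S : Type u} (A : ι → Set S) (hA : ∀ i, #ι ≤ #(A i)) :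
    ∃ g : ι → S, Function.Injective g ∧ ∀ i, g i ∈ A i := by
  -- In a well-order of least type every initial segment is smaller than `ι`, so the values already
  -- used never exhaust `A i`.
  obtain ⟨r, hr, hord⟩ := exists_ord_eq ι
  have key : ∀ (i : ι) (f : ∀ j, r j i → S), ∃ s ∈ A i, ∀ j hj, f j hj ≠ s := by
    intro i f
    by_contra! hcon
    have hsub : A i ⊆ Set.range (fun j : {j // r j i} ↦ f j.1 j.2) := by
      intro s hs
      obtain ⟨j, hj, e⟩ := hcon s hs
      exact ⟨⟨j, hj⟩, e⟩
    have h1 : #(A i) ≤ #{j // r j i} := (mk_le_mk_of_subset hsub).trans mk_range_le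
    exact absurd ((hA i).trans h1) (not_le.2 (Ordinal.card_typein (r := r) i ▸ card_typein_lt i hord))
  choose c hc hne using key
  let g : ι → S := (IsWellFounded.wf (r := r)).fix fun i f ↦ c i f
  have hg : ∀ i, g i = c i fun j _ ↦ g j := fun i ↦ WellFounded.fix_eq _ _ _
  have hlt : ∀ i j, r j i → g j ≠ g i := fun i j hj ↦ by
    rw [hg i]; exact hne i (fun j _ ↦ g j) j hj
  refine ⟨g, fun i j hij ↦ ?_, fun i ↦ by rw [hg]; exact hc _ _⟩
  rcases trichotomous_of r i j with h | h | h
  · exact absurd hij (hlt _ _ h)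
  · exact h
  · exact absurd hij.symm (hlt _ _ h)

/-- A closed set is determined by the members of a countable base disjoint from it. -/
theorem mk_isClosed_le_continuum (M : Type u) [TopologicalSpace M] [SecondCountableTopology M] :
    #{K : Set M // IsClosed K} ≤ 𝔠 := by
  obtain ⟨B, hBc, -, hB⟩ := TopologicalSpace.exists_countable_basis M
  let φ : {K : Set M // IsClosed K} → Set B := fun K ↦ {b | Disjoint (b : Set M) K}
  have key : ∀ K : {K : Set M // IsClosed K}, (K : Set M)ᶜ = ⋃ b ∈ φ K, (b : Set M) := by
    intro K
    ext x
    simp only [Set.mem_iUnion, exists_prop]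
    constructor
    · intro hx
      obtain ⟨b, hb, hxb, hbK⟩ := hB.exists_subset_of_mem_open hx K.2.isOpen_compl
      exact ⟨⟨b, hb⟩, Set.disjoint_left.2 fun y hy hyK ↦ hbK hy hyK, hxb⟩
    · rintro ⟨b, hb, hxb⟩ hxK
      exact Set.disjoint_left.1 hb hxb hxK
  have hφ : Function.Injective φ := fun K K' h ↦
    Subtype.ext (compl_injective (by rw [key K, key K', h]))
  refine (mk_le_of_injective hφ).trans ?_
  rw [mk_set, ← two_power_aleph0]
  exact power_le_power_left two_ne_zero (mk_le_aleph0_iff.2 hBc)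

theorem mk_le_continuum_of_secondCountable (M : Type u) [TopologicalSpace M]
    [SecondCountableTopology M] [T1Space M] : #M ≤ 𝔠 :=
  (mk_le_of_injective (f := fun x : M ↦ (⟨{x}, isClosed_singleton⟩ : {K : Set M // IsClosed K}))
    fun _ _ h ↦ Set.singleton_injective (congrArg Subtype.val h)).trans
    (mk_isClosed_le_continuum M)

theorem IsClosed.continuum_le_mk {M : Type u} [TopologicalSpace M] [PolishSpace M] {K : Set M}
    (hK : IsClosed K) (hunc : ¬ K.Countable) : 𝔠 ≤ #K := by
  obtain ⟨f, hf, -, hinj⟩ := hK.exists_nat_bool_injection_of_not_countable hunc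
  have : lift.{u} #(ℕ → Bool) ≤ lift.{0} #K := by
    refine lift_mk_le'.2 ⟨⟨fun t ↦ ⟨f t, hf ⟨t, rfl⟩⟩, fun a b h ↦ hinj ?_⟩⟩
    exact congrArg Subtype.val h
  simpa using this

/-! ### Independent families of size continuum. -/

namespace GroupVariety

variable {V : GroupVariety.{u}}

/-- An independent family of size continuum can be reindexed so that the subgroup it generates
has no uncountable closed subsets. -/
theorem IndepFamily.exists_reindex {S T M : Type u} [Group M] [TopologicalSpace M] [PolishSpace M]
    (hM : V.Mem M) {y : S → M} (hy : V.IndepFamily y) (hS : #S = 𝔠) (hT : #T ≤ 𝔠) :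
    ∃ j : T → S, Function.Injective j ∧ ∀ K : Set M, IsClosed K →
      K ⊆ Subgroup.closure (Set.range (y ∘ j)) → K.Countable := by
  let 𝒦 := {K : {K : Set M // IsClosed K} //
    ¬ (K : Set M).Countable ∧ (K : Set M) ⊆ Subgroup.closure (Set.range y)}
  -- An injective choice picks for each `K` a generator to discard, one that `K` cannot do without,
  -- and keeps the generators chosen for `T`.
  let A : 𝒦 ⊕ T → Set S := Sum.elim
    (fun K ↦ {s | ¬ (K.1 : Set M) ⊆ Subgroup.closure (y '' {s}ᶜ)}) fun _ ↦ Set.univ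
  have hcard : #(𝒦 ⊕ T) ≤ 𝔠 := by
    rw [mk_sum, lift_id, lift_id, ← continuum_add_self]
    exact add_le_add ((mk_subtype_le _).trans (mk_isClosed_le_continuum M)) hT
  obtain ⟨g, hg, hgA⟩ := exists_injective_forall_mem A fun i ↦ hcard.trans <| by
    rcases i with K | t
    -- Otherwise `K` would lie in a subgroup with fewer than 𝔠 generators, although |K| ≥ 𝔠.
    · by_contra! hlt
      have hsub : (K.1 : Set M) ⊆ Subgroup.closure (y '' A (Sum.inl K)) := fun k hk ↦
        Subgroup.closure_mono (Set.image_mono fun s (hs : k ∉ Subgroup.closure (y '' {s}ᶜ))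
          (hK : (K.1 : Set M) ⊆ _) ↦ hs (hK hk)) (hy.exists_support hM (K.2.2 hk))
      have h1 : 𝔠 ≤ max #(A (Sum.inl K)) ℵ₀ :=
        (K.1.2.continuum_le_mk K.2.1).trans <| (mk_le_mk_of_subset hsub).trans <|
          (Subgroup.mk_closure_le _).trans (max_le_max mk_image_le le_rfl)
      exact absurd h1 (not_le.2 (max_lt hlt aleph0_lt_continuum))
    · simp [A, hS]
  refine ⟨g ∘ Sum.inr, hg.comp Sum.inr_injective, fun K hK hsub ↦ ?_⟩
  by_contra hunc
  have hK' : K ⊆ Subgroup.closure (Set.range y) := hsub.trans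
    (Subgroup.closure_mono (Set.range_comp_subset_range _ _))
  refine hgA (Sum.inl ⟨⟨K, hK⟩, hunc, hK'⟩) (hsub.trans (Subgroup.closure_mono ?_))
  rintro _ ⟨t, rfl⟩
  exact ⟨g (Sum.inr t), fun h ↦ Sum.inr_ne_inl (hg h), rfl⟩

theorem exists_indepFamily_of_finite {G : Type u} [Group G] (h : ℵ₀ ≤ V.rank G) (E : Type)
    [Finite E] : ∃ e : E → G, Function.Injective e ∧ V.IndepFamily e := by
  have hlt : lift.{u} #E < V.rank G := lt_of_lt_of_le (by simp) h
  obtain ⟨X, hX⟩ := (lt_ciSup_iff' bddAbove_of_small).1 hlt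
  obtain ⟨f⟩ := lift_mk_le'.1 (hX.le.trans (lift_id'.{0, u} #X.1).ge)
  exact ⟨fun a ↦ f a, Subtype.val_injective.comp f.injective,
    X.2.indepFamily.comp_injective f.injective⟩

/-- If `G` has independent subsets of all finite sizes then `G ^ ω` has an independent subset
of size continuum. -/
theorem exists_indepFamily_nat_bool {G : Type u} [Group G] (h : ℵ₀ ≤ V.rank G) :
    ∃ y : (ℕ → Bool) → (ℕ → G), Function.Injective y ∧ V.IndepFamily y := by
  choose e he hind using fun n : ℕ ↦ exists_indepFamily_of_finite (V := V) h (Fin n → Bool)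
  refine ⟨fun t n ↦ e n fun i ↦ t i, fun t t' htt' ↦ funext fun n ↦ ?_, .of_finset fun F ↦ ?_⟩
  · exact congrFun (he (n + 1) (congrFun htt' (n + 1))) (Fin.last n)
  · have hsep : ∀ p : F × F, ∃ n : ℕ, p.1 ≠ p.2 → p.1.1 n ≠ p.2.1 n := fun p ↦ by
      by_cases hp : p.1 = p.2
      · exact ⟨0, fun h ↦ absurd hp h⟩
      · obtain ⟨n, hn⟩ := Function.ne_iff.1 (Subtype.coe_ne_coe.2 hp)
        exact ⟨n, fun _ ↦ hn⟩
    choose d hd using hsep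
    obtain ⟨N, hN⟩ := (Set.finite_range d).bddAbove
    -- Coordinate `N + 1` sees the bits 0, …, N, which separate the members of `F`.
    refine .of_hom_comp (Pi.evalMonoidHom (fun _ ↦ G) (N + 1)) ?_
    refine (hind (N + 1)).comp_injective (j := fun (t : F) (i : Fin (N + 1)) ↦ t.1 i) ?_
    intro t t' htt'
    by_contra hne
    exact hd (t, t') hne
      (congrFun htt' ⟨d (t, t'), Nat.lt_succ_of_le (hN ⟨_, rfl⟩)⟩)

end GroupVariety

/-! ### Subsets projecting onto all countable subproducts; weight. -/

/-- `D` projects onto every countable subproduct. -/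
def AgreesOnCountable {I L : Type*} (D : Set (I → L)) : Prop :=
  ∀ (p : I → L) (J : Set I), J.Countable → ∃ d ∈ D, ∀ i ∈ J, d i = p i

theorem IsOpen.exists_finset_agree {I L : Type*} [TopologicalSpace L] {U : Set (I → L)}
    (hU : IsOpen U) {p : I → L} (hp : p ∈ U) :
    ∃ F : Finset I, ∀ q : I → L, (∀ i ∈ F, q i = p i) → q ∈ U := by
  obtain ⟨F, u, hu, hsub⟩ := isOpen_pi_iff.1 hU p hp
  exact ⟨F, fun q hq ↦ hsub fun i hi ↦ by rw [hq i hi]; exact (hu i hi).2⟩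

namespace AgreesOnCountable

theorem gDeltaDense {I L : Type u} [TopologicalSpace L] {D : Set (I → L)}
    (hD : AgreesOnCountable D) : GDeltaDense D := by
  rintro B hB ⟨p, hp⟩
  obtain ⟨U, hU, rfl⟩ := hB.eq_iInter_nat
  rw [Set.mem_iInter] at hp
  choose F hF using fun n ↦ (hU n).exists_finset_agree (hp n)
  obtain ⟨d, hd, hdp⟩ := hD p (⋃ n, (F n : Set I))
    (Set.countable_iUnion fun n ↦ (F n).countable_toSet)
  exact ⟨d, hd, Set.mem_iInter.2 fun n ↦ hF n d fun i hi ↦ hdp i (Set.mem_iUnion.2 ⟨n, hi⟩)⟩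

/-- If |f(d n)| > n, each such bound is forced by finitely many coordinates, all in a countable `J`.
Take `a ∈ D` agreeing on `J` with a cluster point of the `d n`. A point of `D` that copies a
suitable `d n` on `J` and `a` on the rest of a finite set is both close to `a` and has |f| > n. -/
theorem isPseudocompact {I L : Type u} [TopologicalSpace L] [CompactSpace L] {D : Set (I → L)}
    (hD : AgreesOnCountable D) : IsPseudocompact D := by
  classical
  intro f hf
  by_contra! hunb
  choose d hd using fun n : ℕ ↦ hunb n
  have hF : ∀ n, ∃ F : Finset I, ∀ x : D, (∀ i ∈ F, x.1 i = (d n).1 i) → (n : ℝ) < |f x| := by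
    intro n
    obtain ⟨W, hW, hWeq⟩ := isOpen_induced_iff.1 (isOpen_lt continuous_const hf.abs :
      IsOpen {x : D | (n : ℝ) < |f x|})
    have hmem : ∀ x : D, x.1 ∈ W ↔ (n : ℝ) < |f x| := fun x ↦ Set.ext_iff.1 hWeq x
    obtain ⟨F, hF⟩ := hW.exists_finset_agree ((hmem (d n)).2 (hd n))
    exact ⟨F, fun x hx ↦ (hmem x).1 (hF x.1 hx)⟩
  choose F hF using hF
  let J : Set I := ⋃ n, (F n : Set I)
  have hJ : J.Countable := Set.countable_iUnion fun n ↦ (F n).countable_toSet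
  obtain ⟨p, -, hp⟩ := isCompact_univ.exists_mapClusterPt (u := fun n ↦ (d n).1)
    (f := Filter.atTop) (by simp)
  obtain ⟨a, ha, hap⟩ := hD p J hJ
  obtain ⟨W, hW, hWeq⟩ := isOpen_induced_iff.1 (isOpen_lt hf.abs continuous_const :
    IsOpen {x : D | |f x| < |f ⟨a, ha⟩| + 1})
  have hmem : ∀ x : D, x.1 ∈ W ↔ |f x| < |f ⟨a, ha⟩| + 1 := fun x ↦ Set.ext_iff.1 hWeq x
  obtain ⟨E, v, hv, hsub⟩ := isOpen_pi_iff.1 hW a ((hmem ⟨a, ha⟩).2 (by simp))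
  have hnhds : {x : I → L | ∀ i ∈ E, i ∈ J → x i ∈ v i} ∈ nhds p := by
    have : {x : I → L | ∀ i ∈ E, i ∈ J → x i ∈ v i} =
        ⋂ i ∈ E, {x : I → L | i ∈ J → x i ∈ v i} := by ext; simp
    rw [this, Filter.biInter_finset_mem]
    intro i hi
    by_cases hiJ : i ∈ J
    · simp only [hiJ, true_imp_iff]
      exact (continuous_apply i).continuousAt.preimage_mem_nhds
        ((hv i hi).1.mem_nhds (hap i hiJ ▸ (hv i hi).2))
    · simp [hiJ]
  obtain ⟨m, hm⟩ := exists_nat_ge (|f ⟨a, ha⟩| + 1)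
  obtain ⟨n, hmn, hn⟩ := Filter.frequently_atTop.1
    (mapClusterPt_iff_frequently.1 hp _ hnhds) m
  obtain ⟨x, hx, hxq⟩ := hD (fun i ↦ if i ∈ J then (d n).1 i else a i) (J ∪ E)
    (hJ.union E.countable_toSet)
  have h1 : (n : ℝ) < |f ⟨x, hx⟩| := hF n ⟨x, hx⟩ fun i hi ↦ by
    have hiJ : i ∈ J := Set.mem_iUnion.2 ⟨n, hi⟩
    simpa [hiJ] using hxq i (Or.inl hiJ)
  have h2 : |f ⟨x, hx⟩| < |f ⟨a, ha⟩| + 1 := (hmem ⟨x, hx⟩).1 <| hsub fun i hi ↦ by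
    change x i ∈ v i
    rw [hxq i (Or.inr hi)]
    by_cases hiJ : i ∈ J
    · simpa [hiJ] using hn i hi hiJ
    · simpa [hiJ] using (hv i hi).2
  have h3 : (m : ℝ) ≤ n := by exact_mod_cast hmn
  linarith

/-- A countable neighbourhood base at `a` would control only countably many coordinates; altering
one further coordinate gives another point in every basic neighbourhood. -/
theorem not_firstCountable {I L : Type*} [TopologicalSpace L] [T1Space L] [Nontrivial L]
    [Uncountable I] {D : Set (I → L)} (hD : AgreesOnCountable D) :
    ¬ FirstCountableTopology D := by
  classical
  intro hfc
  obtain ⟨l₀⟩ : Nonempty L := inferInstance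
  obtain ⟨a, ha, -⟩ := hD (fun _ ↦ l₀) ∅ Set.countable_empty
  obtain ⟨U, hU⟩ := (nhds (⟨a, ha⟩ : D)).exists_antitone_basis
  have hF : ∀ n, ∃ F : Finset I, ∀ x : D, (∀ i ∈ F, x.1 i = a i) → x ∈ U n := by
    intro n
    obtain ⟨W, hW, hWU⟩ := mem_nhds_subtype D ⟨a, ha⟩ (U n) |>.1 (hU.mem n)
    obtain ⟨O, hOW, hO, haO⟩ := mem_nhds_iff.1 hW
    obtain ⟨F, hF⟩ := hO.exists_finset_agree haO
    exact ⟨F, fun x hx ↦ hWU (hOW (hF x.1 hx))⟩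
  choose F hF using hF
  let J : Set I := ⋃ n, (F n : Set I)
  have hJ : J.Countable := Set.countable_iUnion fun n ↦ (F n).countable_toSet
  obtain ⟨i, hi⟩ := Set.ne_univ_iff_exists_notMem J |>.1 fun h ↦
    Set.not_countable_univ (h ▸ hJ)
  obtain ⟨l, hl⟩ := exists_ne (a i)
  obtain ⟨x, hx, hxa⟩ := hD (Function.update a i l) (insert i J) (hJ.insert i)
  have hxi : x i = l := by simpa using hxa i (Set.mem_insert _ _)
  have hxmem : ∀ n, (⟨x, hx⟩ : D) ∈ U n := fun n ↦ hF n _ fun k hk ↦ by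
    have hkJ : k ∈ J := Set.mem_iUnion.2 ⟨n, hk⟩
    have hki : k ≠ i := fun h ↦ hi (h ▸ hkJ)
    simpa [hki] using hxa k (Set.mem_insert_of_mem _ hkJ)
  have hne : (⟨a, ha⟩ : D) ≠ ⟨x, hx⟩ := fun h ↦ hl (by
    rw [← hxi]; exact (congrFun (congrArg Subtype.val h) i).symm)
  obtain ⟨n, hn⟩ := hU.mem_iff.1 (isOpen_ne.mem_nhds hne)
  exact hn (hxmem n) rfl

end AgreesOnCountable

theorem GDeltaDense.dense {X : Type u} [TopologicalSpace X] {D : Set X} (hD : GDeltaDense D) :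
    Dense D :=
  dense_iff_inter_open.2 fun U hU hne ↦ Set.inter_comm D U ▸ hD U hU.isGδ hne

theorem secondCountable_of_topWeight_le {X : Type u} [TopologicalSpace X]
    (h : topWeight X ≤ ℵ₀) : SecondCountableTopology X := by
  obtain ⟨B, hB, hBc⟩ := csInf_mem (s := {κ | ∃ B : Set (Set X),
    TopologicalSpace.IsTopologicalBasis B ∧ #B = κ})
    ⟨_, {U | IsOpen U}, TopologicalSpace.isTopologicalBasis_opens, rfl⟩
  exact hB.secondCountableTopology (mk_le_aleph0_iff.1 (hBc.le.trans h))

theorem topWeight_le_aleph0 (X : Type u) [TopologicalSpace X] [SecondCountableTopology X] :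
    topWeight X ≤ ℵ₀ := by
  obtain ⟨B, hBc, -, hB⟩ := TopologicalSpace.exists_countable_basis X
  have h : topWeight X ≤ #B := csInf_le' ⟨B, hB, rfl⟩
  exact h.trans (mk_le_aleph0_iff.2 hBc)

/-- Countably many coordinates separate the points, so compactness embeds the space in a countable
power of `L`. -/
theorem secondCountable_of_compact_countable {I L X : Type*} [TopologicalSpace L] [T2Space L]
    [SecondCountableTopology L] [TopologicalSpace X] [CompactSpace X] [Countable X]
    {f : X → I → L} (hf : Continuous f) (hinj : Function.Injective f) :
    SecondCountableTopology X := by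
  have hsep : ∀ p : {p : X × X // p.1 ≠ p.2}, ∃ i, f p.1.1 i ≠ f p.1.2 i := fun p ↦
    Function.ne_iff.1 (hinj.ne p.2)
  choose k hk using hsep
  have hcont : Continuous fun x (p : {p : X × X // p.1 ≠ p.2}) ↦ f x (k p) :=
    continuous_pi fun p ↦ (continuous_apply (k p)).comp hf
  refine (hcont.isClosedEmbedding fun x x' h ↦ ?_).isEmbedding.secondCountableTopology
  by_contra hne
  exact hk ⟨(x, x'), hne⟩ (congrFun h ⟨(x, x'), hne⟩)

theorem not_isWCompact {I L : Type u} [TopologicalSpace L] [T2Space L]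
    [SecondCountableTopology L] [Nontrivial L] [Uncountable I] {D : Set (I → L)}
    (hD : AgreesOnCountable D) (hC : ∀ C : Set D, IsCompact C → C.Countable) :
    ¬ IsWCompact D := by
  rintro ⟨C, hcomp, hw⟩
  have := isCompact_iff_compactSpace.1 hcomp
  have := (hC C hcomp).to_subtype
  have := secondCountable_of_compact_countable (f := fun x : C ↦ (x : D).1)
    (continuous_subtype_val.comp continuous_subtype_val)
    (Subtype.val_injective.comp Subtype.val_injective)
  have := secondCountable_of_topWeight_le (hw ▸ topWeight_le_aleph0 C)
  exact hD.not_firstCountable inferInstance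

/-! ### Spreading a family over the blocks of `L^I`. -/

section Blocks

variable {I L : Type u}

/-- The restriction of a point of `L ^ I` to the block `β × ℕ × ℕ` of `I ≃ I × ℕ × ℕ`. -/
def block [Group L] (e : I ≃ I × ℕ × ℕ) (β : I) : (I → L) →* (ℕ → ℕ → L) where
  toFun p n m := p (e.symm (β, n, m))
  map_one' := rfl
  map_mul' _ _ := rfl

theorem continuous_block [Group L] [TopologicalSpace L] (e : I ≃ I × ℕ × ℕ) (β : I) :
    Continuous (block (L := L) e β) :=
  continuous_pi fun _ ↦ continuous_pi fun _ ↦ continuous_apply _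

open Classical in
/-- For `t = (s, v)`, the point of `L ^ I` whose block at `s k` is prescribed by `v`, and whose
other blocks are all equal to `y t`. -/
noncomputable def spread (e : I ≃ I × ℕ × ℕ) (y : (ℕ → I) × (ℕ → ℕ → ℕ → L) → ℕ → ℕ → L)
    (t : (ℕ → I) × (ℕ → ℕ → ℕ → L)) : I → L := fun i ↦
  (if h : ∃ k, t.1 k = (e i).1 then t.2 (Nat.find h) else y t) (e i).2.1 (e i).2.2

variable [Group L] {e : I ≃ I × ℕ × ℕ} {y : (ℕ → I) × (ℕ → ℕ → ℕ → L) → ℕ → ℕ → L}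

theorem block_spread {t : (ℕ → I) × (ℕ → ℕ → ℕ → L)} {β : I} (hβ : β ∉ Set.range t.1) :
    block e β (spread e y t) = y t := by
  have : ¬ ∃ k, t.1 k = β := hβ
  funext n m
  simp [block, spread, this]

theorem agreesOnCountable_range_spread [Nonempty I] :
    AgreesOnCountable (Set.range (spread e y)) := by
  classical
  intro p J hJ
  -- Here `s` enumerates the blocks meeting `J`; `β₀` only ensures that there is something to
  -- enumerate.
  obtain ⟨β₀⟩ := ‹Nonempty I›
  obtain ⟨s, hs⟩ := ((hJ.image fun i ↦ (e i).1).insert β₀).exists_eq_range ⟨β₀, by simp⟩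
  refine ⟨_, ⟨(s, fun k ↦ block e (s k) p), rfl⟩, fun i hi ↦ ?_⟩
  have h : ∃ k, s k = (e i).1 := by
    have : (e i).1 ∈ Set.range s := hs ▸ Set.mem_insert_of_mem _ ⟨i, hi, rfl⟩
    exact this
  have h' := Nat.find_spec h
  simp [spread, h, block, h']

/-- A word has finitely many letters, each exceptional on countably many blocks only. -/
theorem exists_countable_block_lift_spread (w : FreeGroup ((ℕ → I) × (ℕ → ℕ → ℕ → L))) :
    ∃ J : Set I, J.Countable ∧ ∀ β ∉ J,
      block e β (FreeGroup.lift (spread e y) w) = FreeGroup.lift y w := by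
  induction w using FreeGroup.induction_on with
  | C1 => exact ⟨∅, Set.countable_empty, by simp⟩
  | of t => exact ⟨Set.range t.1, Set.countable_range _, fun β hβ ↦ by simp [block_spread hβ]⟩
  | inv_of t _ =>
    exact ⟨Set.range t.1, Set.countable_range _, fun β hβ ↦ by simp [block_spread hβ]⟩
  | mul a b ha hb =>
    obtain ⟨J, hJ, h⟩ := ha
    obtain ⟨J', hJ', h'⟩ := hb
    refine ⟨J ∪ J', hJ.union hJ', fun β hβ ↦ ?_⟩
    rw [Set.mem_union, not_or] at hβ
    rw [map_mul, map_mul, map_mul, h β hβ.1, h' β hβ.2]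

theorem Set.Countable.exists_notMem {I : Type*} [Uncountable I] {J : Set I} (hJ : J.Countable) :
    ∃ i, i ∉ J :=
  (Set.ne_univ_iff_exists_notMem J).1 fun h ↦ Set.not_countable_univ (h ▸ hJ)

theorem lift_eq_of_lift_spread_eq [Uncountable I]
    {w w' : FreeGroup ((ℕ → I) × (ℕ → ℕ → ℕ → L))}
    (h : FreeGroup.lift (spread e y) w = FreeGroup.lift (spread e y) w') :
    FreeGroup.lift y w = FreeGroup.lift y w' := by
  obtain ⟨J, hJ, hw⟩ := exists_countable_block_lift_spread (e := e) (y := y) w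
  obtain ⟨J', hJ', hw'⟩ := exists_countable_block_lift_spread (e := e) (y := y) w'
  obtain ⟨β, hβ⟩ := (hJ.union hJ').exists_notMem
  rw [Set.mem_union, not_or] at hβ
  rw [← hw β hβ.1, ← hw' β hβ.2, h]

theorem GroupVariety.IndepFamily.spread {V : GroupVariety.{u}} [Uncountable I]
    (hy : V.IndepFamily y) : V.IndepFamily (spread e y) := fun w hw ↦
  hy w (by simpa using lift_eq_of_lift_spread_eq (w' := 1) (hw.trans (map_one _).symm))

theorem spread_injective [Uncountable I] (hy : Function.Injective y) :
    Function.Injective (spread e y) := fun t t' h ↦ hy <| by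
  simpa using lift_eq_of_lift_spread_eq (e := e) (y := y) (w := .of t) (w' := .of t') (by simpa)

/-- Replacing `spread e y` by `y` in words carries compact sets to closed sets. -/
theorem isClosed_lift_image [TopologicalSpace L] [T2Space L] [FirstCountableTopology L]
    [Uncountable I] {W : Set (FreeGroup ((ℕ → I) × (ℕ → ℕ → ℕ → L)))}
    (hW : IsCompact (FreeGroup.lift (spread e y) '' W)) :
    IsClosed (FreeGroup.lift y '' W) := by
  refine isClosed_of_closure_subset fun z hz ↦ ?_
  obtain ⟨c, hcW, hcz⟩ := mem_closure_iff_seq_limit.1 hz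
  choose w hw hwc using hcW
  choose J hJ hblock using fun n ↦ exists_countable_block_lift_spread (e := e) (y := y) (w n)
  obtain ⟨_, ⟨w', hw', rfl⟩, hclus⟩ := hW.exists_mapClusterPt
    (u := fun n ↦ FreeGroup.lift (spread e y) (w n)) (f := Filter.atTop)
    (Filter.tendsto_principal.2 (.of_forall fun n ↦ ⟨w n, hw n, rfl⟩))
  obtain ⟨J', hJ', hblock'⟩ := exists_countable_block_lift_spread (e := e) (y := y) w'
  -- On a block outside all the exceptional sets, the words `w n` read as the sequence `c`, which
  -- tends to `z`, and the cluster point reads as `FreeGroup.lift y w'`; hence the two coincide.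
  obtain ⟨β, hβ⟩ := (hJ'.union (Set.countable_iUnion hJ)).exists_notMem
  rw [Set.mem_union, not_or, Set.mem_iUnion, not_exists] at hβ
  refine ⟨w', hw', ?_⟩
  have h1 := hclus.continuousAt_comp (continuous_block e β).continuousAt
  have h2 : block e β ∘ (fun n ↦ FreeGroup.lift (spread e y) (w n)) = c := by
    funext n
    rw [Function.comp_apply, hblock n β (hβ.2 n), hwc]
  rw [h2, hblock' β hβ.1] at h1
  exact eq_of_nhds_neBot (Filter.NeBot.mono h1 (inf_le_inf_left _ hcz))

theorem countable_of_isCompact_closure_spread {V : GroupVariety.{u}} [TopologicalSpace L]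
    [T2Space L] [FirstCountableTopology L] [Uncountable I] (hL : V.Mem L) (hy : V.IndepFamily y)
    (hcl : ∀ K : Set (ℕ → ℕ → L), IsClosed K →
      K ⊆ Subgroup.closure (Set.range y) → K.Countable)
    {C : Set (I → L)} (hC : IsCompact C)
    (hsub : C ⊆ Subgroup.closure (Set.range (spread e y))) : C.Countable := by
  rw [← FreeGroup.range_lift_eq_closure] at hsub
  let W := FreeGroup.lift (spread e y) ⁻¹' C
  have hW : FreeGroup.lift (spread e y) '' W = C := Set.image_preimage_eq_of_subset hsub
  have hcount : (FreeGroup.lift y '' W).Countable := by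
    refine hcl _ (isClosed_lift_image (hW ▸ hC)) ?_
    rintro _ ⟨w, -, rfl⟩
    rw [← FreeGroup.range_lift_eq_closure]
    exact ⟨w, rfl⟩
  -- One word per value in `y` suffices: words with equal value in `y` differ by a law, so they
  -- agree in the spread family too.
  choose! r hrW hr using fun z (hz : z ∈ FreeGroup.lift y '' W) ↦ hz
  refine (hcount.image fun z ↦ FreeGroup.lift (spread e y) (r z)).mono ?_
  rw [← hW]
  rintro _ ⟨w, hw, rfl⟩
  have hmem : FreeGroup.lift y w ∈ FreeGroup.lift y '' W := ⟨w, hw, rfl⟩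
  exact ⟨_, hmem, hy.lift_eq_lift (hr _ hmem) (V.pi_mem I _ fun _ ↦ hL) _⟩

end Blocks

/-! ### Assembling the subgroup. -/

theorem theorem5p2 (V : GroupVariety.{u}) (L : Type u) [Group L] [TopologicalSpace L]
    [IsTopologicalGroup L] [CompactSpace L] [TopologicalSpace.MetrizableSpace L]
    (hL : V.Mem L) (hrank : ℵ₀ ≤ V.rank (ℕ → L))
    (I : Type u) (hI : ℵ₁ ≤ #I) (hI' : #I ≤ 𝔠) :
    ∃ D : Subgroup (I → L),
      GDeltaDense (D : Set (I → L)) ∧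
      Dense (D : Set (I → L)) ∧
      IsPseudocompact D ∧
      V.IsFree D ∧
      #D = 𝔠 ∧
      (∀ C : Set D, IsCompact C → C.Countable) ∧
      ¬ IsWCompact D := by
  have hPolish : PolishSpace L := by
    let := TopologicalSpace.metrizableSpaceMetric L
    infer_instance
  have hunc : Uncountable I := aleph0_lt_mk_iff.1 (aleph0_lt_aleph_one.trans_le hI)
  have hnt : Nontrivial L := by
    by_contra h
    rw [not_nontrivial_iff_subsingleton] at h
    obtain ⟨f, hf, -⟩ := GroupVariety.exists_indepFamily_of_finite hrank Bool
    exact absurd (hf (Subsingleton.elim (f true) (f false))) (by simp)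
  obtain ⟨e⟩ : Nonempty (I ≃ I × ℕ × ℕ) := by
    refine Cardinal.eq.1 ?_
    simp [mul_aleph0_eq (aleph0_le_mk I)]
  let T := (ℕ → I) × (ℕ → ℕ → ℕ → L)
  have hLc : #L ≤ 𝔠 := mk_le_continuum_of_secondCountable L
  have hpow : ∀ {α : Type u}, #α ≤ 𝔠 → #(ℕ → α) ≤ 𝔠 := fun {α} h ↦ by
    rw [← continuum_power_aleph0]
    simpa using power_le_power_right h (c := ℵ₀)
  have hT : #T = 𝔠 := by
    have hI2 : #(ℕ → I) = 𝔠 := by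
      have h2 : (2 : Cardinal) ≤ #I := (natCast_lt_aleph0 (n := 2)).le.trans (aleph0_le_mk I)
      simpa using power_aleph0_of_le_continuum h2 hI'
    refine le_antisymm ?_ ?_
    · rw [mk_prod, lift_id, lift_id, ← continuum_mul_self]
      exact mul_le_mul' hI2.le (hpow (hpow (hpow hLc)))
    · rw [← hI2]
      exact mk_le_of_surjective (f := Prod.fst) Prod.fst_surjective
  have hM : V.Mem (ℕ → ℕ → L) := V.mem_pi (V.mem_pi hL)
  obtain ⟨y₀, hy₀, hind₀⟩ := GroupVariety.exists_indepFamily_nat_bool hrank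
  -- `ULift` only moves the index set of bit strings into the universe of `T`.
  obtain ⟨j, hj, hcl⟩ := (hind₀.comp_injective ULift.down_injective).exists_reindex
    (S := ULift.{u} (ℕ → Bool)) hM (by simp) hT.le
  set y : T → ℕ → ℕ → L := (y₀ ∘ ULift.down) ∘ j
  have hyinj : Function.Injective y := (hy₀.comp ULift.down_injective).comp hj
  have hind : V.IndepFamily y := (hind₀.comp_injective ULift.down_injective).comp_injective hj
  let D : Subgroup (I → L) := Subgroup.closure (Set.range (spread e y))
  have hagree : AgreesOnCountable (D : Set (I → L)) := fun p J hJ ↦ by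
    obtain ⟨d, hd, h⟩ := agreesOnCountable_range_spread (e := e) (y := y) p J hJ
    exact ⟨d, Subgroup.subset_closure hd, h⟩
  have hcomp : ∀ C : Set D, IsCompact C → C.Countable := fun C hC ↦ by
    refine Set.countable_of_injective_of_countable_image Subtype.val_injective.injOn
      (countable_of_isCompact_closure_spread (e := e) hL hind hcl
        (hC.image continuous_subtype_val) ?_)
    rintro _ ⟨d, -, rfl⟩
    exact d.2
  refine ⟨D, hagree.gDeltaDense, hagree.gDeltaDense.dense, hagree.isPseudocompact, ?_, ?_, hcomp,
    not_isWCompact hagree hcomp⟩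
  · let x : T → D := fun t ↦ ⟨spread e y t, Subgroup.subset_closure ⟨t, rfl⟩⟩
    have hx : V.IndepFamily x := .of_hom_comp D.subtype (hind.spread (e := e))
    refine ⟨Set.range x, hx.independent_range
      (V.subgroup_mem _ _ (V.pi_mem I _ fun _ ↦ hL)), ?_⟩
    rw [← Subgroup.closure_closure_coe_preimage (k := Set.range (spread e y))]
    congr 1
    ext d
    simp only [x, Set.mem_range, Set.mem_preimage, Subtype.ext_iff]
    rfl
  · have hrange : #(Set.range (spread e y)) = 𝔠 := by
      rw [mk_range_eq _ (spread_injective hyinj), hT]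
    refine le_antisymm ?_ ?_
    · exact (Subgroup.mk_closure_le _).trans (max_le hrange.le aleph0_le_continuum)
    · rw [← hrange]
      exact mk_le_mk_of_subset Subgroup.subset_closure
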